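/- Fix masses $m_1,m_2,m_3>0$ and lengths $l_1,l_2,l_3>0$. For $k_1,F\in\mathbb R$ put $$A_{11}=m_1l_1^2+m_3l_3^2,\qquad A_{12}=A_{21}=m_1l_1^2+m_3l_3^2+(m_1l_1l_2-m_3l_2l_3)\cos\varphi_1,$$ $$A_{22}=(m_1+m_2+m_3)l_2^2+m_1l_1^2+m_3l_3^2+2(m_1l_1l_2-m_3l_2l_3)\cos\varphi_1,$$ $$r_1=-k_1\varphi_1-(m_1l_1l_2-m_3l_2l_3)\,v_2^2\sin\varphi_1,\qquad r_2=-Fl_1\sin\varphi_1+(m_1l_1l_2-m_3l_2l_3)\,v_1(v_1+2v_2)\sin\varphi_1,$$ and consider the reduced system of the Ziegler pendulum with no spring at the pivot ($k_2=0$), for $(\varphi_1,v_1,v_2)\in\mathbb R^3$: $$\dot\varphi_1=v_1,\qquad \dot v_1=\Bigl(r_1-\tfrac{A_{12}}{A_{22}}r_2\Bigr)\Bigl(A_{11}-\tfrac{A_{12}A_{21}}{A_{22}}\Bigr)^{-1},\qquad \dot v_2=\Bigl(r_2-\tfrac{A_{21}}{A_{11}}r_1\Bigr)\Bigl(A_{22}-\tfrac{A_{12}A_{21}}{A_{11}}\Bigr)^{-1}.$$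 There is a constant $K_1$ such that for every $k_1>K_1$ there is $\varepsilon=\varepsilon(k_1)>0$ such that for all $F$ with $|F|<\varepsilon$ this system has a two-parameter family of periodic solutions. Here a two-parameter family of periodic solutions of $\dot x=X(x)$ means: a nonempty open set $U\subset\mathbb R^2$ and, for each $p\in U$, a solution $\gamma_p:\mathbb R\to\mathbb R^3$ that is periodic with some period $T(p)>0$, such that $\gamma_p(t)$ is continuous in $(p,t)$, $T$ is continuous, $p\mapsto\gamma_p(0)$ is $C^\infty$ on $U$, for every $p\in U$ the vectors $\partial_{p_1}\gamma_p(0)$, $\partial_{p_2}\gamma_p(0)$, $X(\gamma_p(0))$ are linearly independent (so no $\gamma_p$ is constant), and the orbits of $\gamma_p$ and $\gamma_q$ are disjoint whenever $p\ne q$. -/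

import Mathlib

open scoped ContDiff

/-- Masses and rod lengths of the Ziegler pendulum: the rod `OA` of length `l₂` rotates about the
fixed point `O`; the masses `m₂`, `m₁`, `m₃` sit at `A`, `B`, `C`, where `A` lies on the
segment `BC` with `AB = l₁` and `AC = l₃`. -/
structure ZieglerPendulum where
  m₁ : ℝ
  m₂ : ℝ
  m₃ : ℝ
  l₁ : ℝ
  l₂ : ℝ
  l₃ : ℝ
  m₁_pos : 0 < m₁
  m₂_pos : 0 < m₂
  m₃_pos : 0 < m₃
  l₁_pos : 0 < l₁
  l₂_pos : 0 < l₂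
  l₃_pos : 0 < l₃

namespace ZieglerPendulum

/-- Entry `A₁₁` of the mass matrix. -/
def A₁₁ (P : ZieglerPendulum) : ℝ := P.m₁ * P.l₁ ^ 2 + P.m₃ * P.l₃ ^ 2

/-- Entry `A₁₂ = A₂₁` of the mass matrix, as a function of the angle `φ₁`. -/
noncomputable def A₁₂ (P : ZieglerPendulum) (φ₁ : ℝ) : ℝ :=
  P.m₁ * P.l₁ ^ 2 + P.m₃ * P.l₃ ^ 2 + P.m₁ * P.l₁ * P.l₂ * Real.cos φ₁
    - P.m₃ * P.l₂ * P.l₃ * Real.cos φ₁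

/-- Entry `A₂₂` of the mass matrix, as a function of the angle `φ₁`. -/
noncomputable def A₂₂ (P : ZieglerPendulum) (φ₁ : ℝ) : ℝ :=
  P.m₁ * P.l₂ ^ 2 + P.m₁ * P.l₁ ^ 2 + P.m₂ * P.l₂ ^ 2 + P.m₃ * P.l₂ ^ 2 + P.m₃ * P.l₃ ^ 2
    + 2 * P.m₁ * P.l₁ * P.l₂ * Real.cos φ₁ - 2 * P.m₃ * P.l₂ * P.l₃ * Real.cos φ₁

/-- First right-hand side of the Lagrange equations; `k₁` is the stiffness of the spring at `A`
and `v₂` is the angular velocity of `OA`. -/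
noncomputable def r₁ (P : ZieglerPendulum) (k₁ φ₁ v₂ : ℝ) : ℝ :=
  -k₁ * φ₁ - P.m₁ * P.l₁ * P.l₂ * v₂ ^ 2 * Real.sin φ₁
    + P.m₃ * P.l₂ * P.l₃ * v₂ ^ 2 * Real.sin φ₁

/-- Second right-hand side of the Lagrange equations, when the spring at `O` has stiffness
`k₂ = 0`; `F` is the magnitude of the follower force. -/
noncomputable def r₂ (P : ZieglerPendulum) (F φ₁ v₁ v₂ : ℝ) : ℝ :=
  -F * P.l₁ * Real.sin φ₁ + P.m₁ * P.l₁ * P.l₂ * v₁ * (v₁ + 2 * v₂) * Real.sin φ₁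
    - P.m₃ * P.l₂ * P.l₃ * v₁ * (v₁ + 2 * v₂) * Real.sin φ₁

/-- The vector field of the reduced third-order system (`k₂ = 0`) in the variables
`(φ₁, v₁, v₂)`, where `v₁ = φ₁'` and `v₂ = φ₂'`. -/
noncomputable def reducedField (P : ZieglerPendulum) (k₁ F : ℝ) : ℝ × ℝ × ℝ → ℝ × ℝ × ℝ :=
  fun (φ₁, v₁, v₂) =>
    (v₁,
     (P.r₁ k₁ φ₁ v₂ - P.A₁₂ φ₁ / P.A₂₂ φ₁ * P.r₂ F φ₁ v₁ v₂)
        * (P.A₁₁ - P.A₁₂ φ₁ * P.A₁₂ φ₁ / P.A₂₂ φ₁)⁻¹,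
     (P.r₂ F φ₁ v₁ v₂ - P.A₁₂ φ₁ / P.A₁₁ * P.r₁ k₁ φ₁ v₂)
        * (P.A₂₂ φ₁ - P.A₁₂ φ₁ * P.A₁₂ φ₁ / P.A₁₁)⁻¹)

end ZieglerPendulum

/-- The autonomous system `x' = X x` has a two-parameter family of periodic solutions:
solutions `γ p`, defined for all times and periodic with period `T p > 0`, whose parameter `p`
ranges over a nonempty open set `U` of the plane, such that

* `γ p t` depends continuously on `(p, t)`, `T p` on `p`, and the initial point `γ p 0` depends
  smoothly on `p`;
* the two parameters are independent of each other and of time: at every `p ∈ U` the two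
  partial derivatives of the initial point and the velocity `X (γ p 0)` are linearly independent
  (in particular the velocity is nonzero there, so that `γ p` is not an equilibrium);
* distinct parameters give disjoint orbits. -/
def HasTwoParameterFamilyOfPeriodicSolutions {E : Type*} [NormedAddCommGroup E] [NormedSpace ℝ E]
    (X : E → E) : Prop :=
  ∃ (U : Set (ℝ × ℝ)) (γ : ℝ × ℝ → ℝ → E) (T : ℝ × ℝ → ℝ),
    IsOpen U ∧ U.Nonempty ∧
    (∀ p ∈ U, ∀ t : ℝ, HasDerivAt (γ p) (X (γ p t)) t) ∧
    (∀ p ∈ U, 0 < T p ∧ Function.Periodic (γ p) (T p)) ∧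
    ContinuousOn (Function.uncurry γ) (U ×ˢ Set.univ) ∧
    ContinuousOn T U ∧
    ContDiffOn ℝ ∞ (fun p => γ p 0) U ∧
    (∀ p ∈ U, ∀ (a : ℝ × ℝ) (b : ℝ),
      fderiv ℝ (fun q => γ q 0) p a + b • X (γ p 0) = 0 → a = 0 ∧ b = 0) ∧
    (∀ p ∈ U, ∀ q ∈ U, ∀ s t : ℝ, γ p s = γ q t → p = q)

/-!
The system is reversible: the reflection `R (φ₁, v₁, v₂) = (-φ₁, v₁, v₂)` sends solutions to
time-reversed solutions, whether or not `F = 0`. Hence a solution that meets the fixed plane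
`φ₁ = 0` of `R` at times `0` and `τ` is symmetric about both times and has period `2τ`
(`LipschitzWith.solution_periodic_of_reflect`). The plane is two-dimensional, so its points
`(0, a, b)` with small `a > 0` and small `b` serve as the two parameters; the field is transversal
to the plane there, which makes parameters and time independent.

What remains is that these solutions return to the plane. The acceleration is `-h φ₁` with a
continuous coefficient `h` (`ZieglerPendulum.stiffness`) whose value at the origin is positive when
`k₁ > 0` and `|F|` is small. So near the origin `φ₁` is at least as concave as a harmonic
oscillation, and Sturm comparison yields a first return, within a uniform time and with `v₁ < 0`
(`exists_first_return`). By Grönwall's inequality, solutions that start close enough to the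
equilibrium at the origin stay near it during that time. As the return is transversal, `τ` is
continuous in the parameters (`continuous_first_return`), and as the starting points are the only
points of an orbit with `φ₁ = 0` and `v₁ > 0`, distinct parameters give disjoint orbits.

To work with a global flow, the field is composed with the truncation onto a small cube around
the origin, which makes it bounded and globally Lipschitz and keeps it reversible.
-/

open Set Filter Metric
open scoped NNReal Topology

/-! ### Flows of globally Lipschitz fields -/

section Flow

variable {E : Type*} [NormedAddCommGroup E] [NormedSpace ℝ E] {X : E → E} {K : ℝ≥0}

/-- Boundedness lets the Picard–Lindelöf theorem apply on every interval `[-n, n]`; the resulting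
solutions are glued by uniqueness. -/
theorem LipschitzWith.exists_global_flow [CompleteSpace E] (hX : LipschitzWith K X) {L : ℝ≥0}
    (hL : ∀ x, ‖X x‖ ≤ L) :
    ∃ Φ : E → ℝ → E, ∀ x, Φ x 0 = x ∧ ∀ t, HasDerivAt (Φ x) (X (Φ x t)) t := by
  have key : ∀ (x : E) (n : ℕ), ∃ α : ℝ → E, α 0 = x ∧
      ∀ t ∈ Ioo (-(n + 1 : ℝ)) (n + 1), HasDerivAt α (X (α t)) t := by
    intro x n
    have hn : (0 : ℝ) ≤ n := n.cast_nonneg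
    have hpl : IsPicardLindelof (fun _ : ℝ => X) (tmin := -(n + 1 : ℝ)) (tmax := n + 1)
        ⟨0, by constructor <;> linarith⟩ x (L * (n + 1)) 0 L K :=
      { lipschitzOnWith := fun _ _ => hX.lipschitzOnWith
        continuousOn := fun _ _ => continuousOn_const
        norm_le := fun _ _ y _ => hL y
        mul_max_le := by simp }
    obtain ⟨α, h0, hα⟩ := hpl.exists_eq_forall_mem_Icc_hasDerivWithinAt₀
    exact ⟨α, h0, fun t ht =>
      (hα t (Ioo_subset_Icc_self ht)).hasDerivAt (Icc_mem_nhds ht.1 ht.2)⟩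
  choose α h0 hα using key
  have hmono : ∀ (x : E) (m n : ℕ), m ≤ n →
      EqOn (α x m) (α x n) (Ioo (-(m + 1 : ℝ)) (m + 1)) := by
    intro x m n hmn
    have hmn' : (m : ℝ) ≤ n := by exact_mod_cast hmn
    have hm : (0 : ℝ) ≤ m := m.cast_nonneg
    refine ODE_solution_unique_of_mem_Ioo (v := fun _ => X) (s := fun _ => univ) (K := K) (t₀ := 0)
      (fun _ _ => hX.lipschitzOnWith) ⟨by linarith, by linarith⟩
      (fun t ht => ⟨hα x m t ht, mem_univ _⟩)
      (fun t ht => ⟨hα x n t ⟨by linarith [ht.1], by linarith [ht.2]⟩, mem_univ _⟩) ?_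
    rw [h0, h0]
  refine ⟨fun x t => α x ⌊|t|⌋₊ t, fun x => ⟨by simp [h0], fun t => ?_⟩⟩
  have ht : t ∈ Ioo (-(⌊|t|⌋₊ + 1 : ℝ)) (⌊|t|⌋₊ + 1) := abs_lt.1 (Nat.lt_floor_add_one |t|)
  refine (hα x ⌊|t|⌋₊ t ht).congr_of_eventuallyEq ?_
  filter_upwards [Ioo_mem_nhds ht.1 ht.2] with s hs
  have hs' : |s| < ((⌊|t|⌋₊ + 1 : ℕ) : ℝ) := by push_cast; exact abs_lt.2 hs
  have hfl : ⌊|s|⌋₊ ≤ ⌊|t|⌋₊ := Nat.lt_succ_iff.1 ((Nat.floor_lt (abs_nonneg s)).2 hs')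
  exact hmono x _ _ hfl (abs_lt.1 (Nat.lt_floor_add_one |s|))

theorem LipschitzWith.eq_of_hasDerivAt (hX : LipschitzWith K X) {f g : ℝ → E}
    (hf : ∀ t, HasDerivAt f (X (f t)) t) (hg : ∀ t, HasDerivAt g (X (g t)) t) {t₀ : ℝ}
    (h : f t₀ = g t₀) : f = g :=
  ODE_solution_unique_univ (v := fun _ => X) (s := fun _ => univ) (K := K) (t₀ := t₀)
    (fun _ => hX.lipschitzOnWith) (fun t => ⟨hf t, mem_univ _⟩) (fun t => ⟨hg t, mem_univ _⟩) h

theorem LipschitzWith.dist_solution_le (hX : LipschitzWith K X) {f g : ℝ → E}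
    (hf : ∀ t, HasDerivAt f (X (f t)) t) (hg : ∀ t, HasDerivAt g (X (g t)) t) (t : ℝ) :
    dist (f t) (g t) ≤ dist (f 0) (g 0) * Real.exp (K * |t|) := by
  -- Backward time is forward time for the field `-X`.
  have key : ∀ {Y : E → E} (_ : LipschitzWith K Y) {f g : ℝ → E}
      (_ : ∀ t, HasDerivAt f (Y (f t)) t) (_ : ∀ t, HasDerivAt g (Y (g t)) t) (t : ℝ), 0 ≤ t →
      dist (f t) (g t) ≤ dist (f 0) (g 0) * Real.exp (K * t) := by
    intro Y hY f g hf hg t ht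
    have := dist_le_of_trajectories_ODE (v := fun _ => Y) (a := 0) (b := t) (fun _ => hY)
      (HasDerivAt.continuousOn fun s _ => hf s) (fun s _ => (hf s).hasDerivWithinAt)
      (HasDerivAt.continuousOn fun s _ => hg s) (fun s _ => (hg s).hasDerivWithinAt)
      le_rfl t ⟨ht, le_rfl⟩
    simpa using this
  rcases le_total 0 t with ht | ht
  · rw [abs_of_nonneg ht]
    exact key hX hf hg t ht
  · rw [abs_of_nonpos ht]
    have hrev : ∀ {h : ℝ → E}, (∀ t, HasDerivAt h (X (h t)) t) →
        ∀ t, HasDerivAt (fun s => h (-s)) (-X (h (-t))) t := by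
      intro h hh t
      exact ((hh (-t)).scomp t (hasDerivAt_neg t)).congr_deriv (by simp)
    simpa using key (Y := fun x => -X x) hX.neg (hrev hf) (hrev hg) (-t) (by linarith)

theorem LipschitzWith.continuous_flow (hX : LipschitzWith K X) {Φ : E → ℝ → E}
    (h0 : ∀ x, Φ x 0 = x) (hΦ : ∀ x t, HasDerivAt (Φ x) (X (Φ x t)) t) :
    Continuous (Function.uncurry Φ) := by
  rw [continuous_iff_continuousAt]
  rintro ⟨x, t⟩
  have h1 : Tendsto (fun q : E × ℝ => dist q.1 x * Real.exp (K * |q.2|) + dist (Φ x q.2) (Φ x t))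
      (𝓝 (x, t)) (𝓝 0) := by
    have hc : Continuous (Φ x) := continuous_iff_continuousAt.2 fun s => (hΦ x s).continuousAt
    have : Continuous fun q : E × ℝ =>
        dist q.1 x * Real.exp (K * |q.2|) + dist (Φ x q.2) (Φ x t) := by fun_prop
    simpa using this.tendsto (x, t)
  refine tendsto_iff_dist_tendsto_zero.2 (squeeze_zero (fun _ => dist_nonneg) (fun q => ?_) h1)
  refine (dist_triangle _ (Φ x q.2) _).trans (add_le_add_left ?_ _)
  have h := hX.dist_solution_le (hΦ q.1) (hΦ x) q.2
  rw [h0, h0] at h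
  exact h

/-! ### Reversible fields -/

/-- If `R` reverses the field `X`, a solution that meets the fixed set of `R` at time `s` is
symmetric about that time. -/
theorem LipschitzWith.solution_reflect (hX : LipschitzWith K X) {R : E →L[ℝ] E}
    (hR : ∀ x, X (R x) = -R (X x)) {f : ℝ → E} (hf : ∀ t, HasDerivAt f (X (f t)) t) {s : ℝ}
    (hs : R (f s) = f s) (t : ℝ) : R (f (2 * s - t)) = f t := by
  have hd : ∀ t, HasDerivAt (fun t => R (f (2 * s - t))) (X (R (f (2 * s - t)))) t := by
    intro t
    have h1 : HasDerivAt (fun t : ℝ => 2 * s - t) (-1) t := by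
      simpa using (hasDerivAt_id t).const_sub (2 * s)
    have h2 := R.hasFDerivAt.comp_hasDerivAt t ((hf (2 * s - t)).scomp t h1)
    rw [hR]
    exact h2.congr_deriv (by simp)
  refine congrFun (hX.eq_of_hasDerivAt hd hf (t₀ := s) ?_) t
  simp only [two_mul, add_sub_cancel_right, hs]

theorem LipschitzWith.solution_periodic_of_reflect (hX : LipschitzWith K X) {R : E →L[ℝ] E}
    (hR : ∀ x, X (R x) = -R (X x)) {f : ℝ → E} (hf : ∀ t, HasDerivAt f (X (f t)) t)
    (h0 : R (f 0) = f 0) {s : ℝ} (hs : R (f s) = f s) : Function.Periodic f (2 * s) := by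
  intro t
  rw [← hX.solution_reflect hR hf hs (t + 2 * s), ← hX.solution_reflect hR hf h0 t]
  congr 2
  ring

end Flow

/-! ### First return of an oscillating coordinate -/

section Return

/-- Sturm comparison with `sin (c t)`: a function that starts at zero with positive slope and is
at least as concave as a harmonic oscillation of frequency `c` vanishes again before `π / c`. -/
theorem exists_zero_of_sturm {φ v f : ℝ → ℝ} {c : ℝ} (hc : 0 < c)
    (hφ : ∀ t ∈ Icc 0 (Real.pi / c), HasDerivAt φ (v t) t)
    (hv : ∀ t ∈ Icc 0 (Real.pi / c), HasDerivAt v (f t) t)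
    (hf : ∀ t ∈ Icc 0 (Real.pi / c), 0 < φ t → f t ≤ -c ^ 2 * φ t)
    (hφ0 : φ 0 = 0) : ∃ t ∈ Ioc 0 (Real.pi / c), φ t ≤ 0 := by
  by_contra! hpos
  have hT : 0 < Real.pi / c := div_pos Real.pi_pos hc
  -- The Wronskian with `sin (c t)` starts at zero and is nonincreasing, but ends positive.
  set W : ℝ → ℝ := fun t => v t * Real.sin (c * t) - φ t * (c * Real.cos (c * t)) with hW
  have hWd : ∀ t ∈ Icc 0 (Real.pi / c),
      HasDerivAt W ((f t + c ^ 2 * φ t) * Real.sin (c * t)) t := by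
    intro t ht
    have hl : HasDerivAt (fun t : ℝ => c * t) c t := by
      simpa using (hasDerivAt_id t).const_mul c
    have h := ((hv t ht).mul hl.sin).sub ((hφ t ht).mul (hl.cos.const_mul c))
    refine h.congr_deriv ?_
    ring
  have hanti : AntitoneOn W (Icc 0 (Real.pi / c)) := by
    refine antitoneOn_of_hasDerivWithinAt_nonpos (convex_Icc _ _)
      (HasDerivAt.continuousOn hWd)
      (fun t ht => (hWd t (interior_subset ht)).hasDerivWithinAt) fun t ht => ?_
    rw [interior_Icc] at ht
    have h1 := hf t (Ioo_subset_Icc_self ht) (hpos t ⟨ht.1, ht.2.le⟩)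
    have h2 : c * t ≤ Real.pi := by
      have := (lt_div_iff₀ hc).1 ht.2
      linarith
    exact mul_nonpos_of_nonpos_of_nonneg (by linarith)
      (Real.sin_nonneg_of_nonneg_of_le_pi (mul_pos hc ht.1).le h2)
  have h := hanti (left_mem_Icc.2 hT.le) (right_mem_Icc.2 hT.le) hT.le
  have hcπ : c * (Real.pi / c) = Real.pi := by field_simp
  simp only [hW, hcπ, hφ0, mul_zero, Real.sin_zero, Real.sin_pi, Real.cos_pi, zero_mul] at h
  nlinarith [mul_pos (hpos _ (right_mem_Ioc.2 hT)) hc]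

/-- The first return to zero exists and is transversal. -/
theorem exists_first_return {φ v f : ℝ → ℝ} {c : ℝ} (hc : 0 < c)
    (hφ : ∀ t ∈ Icc 0 (Real.pi / c), HasDerivAt φ (v t) t)
    (hv : ∀ t ∈ Icc 0 (Real.pi / c), HasDerivAt v (f t) t)
    (hf : ∀ t ∈ Icc 0 (Real.pi / c), 0 < φ t → f t ≤ -c ^ 2 * φ t)
    (hφ0 : φ 0 = 0) (hv0 : 0 < v 0) :
    ∃ τ ∈ Ioc 0 (Real.pi / c), φ τ = 0 ∧ (∀ t ∈ Ioo 0 τ, 0 < φ t) ∧ v τ < 0 := by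
  have hT : 0 < Real.pi / c := div_pos Real.pi_pos hc
  have hφc : ContinuousOn φ (Icc 0 (Real.pi / c)) := HasDerivAt.continuousOn hφ
  obtain ⟨η, hη, hηpos⟩ : ∃ η > 0, ∀ t ∈ Ioo 0 η, 0 < φ t := by
    have hd := (hφ 0 (left_mem_Icc.2 hT.le)).hasDerivWithinAt (s := Ioi 0)
    have h := (hasDerivWithinAt_iff_tendsto_slope' (by simp)).1 hd
    have h2 := h.eventually (lt_mem_nhds hv0)
    obtain ⟨η, hη, hsub⟩ := mem_nhdsGT_iff_exists_Ioo_subset.1 h2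
    refine ⟨η, hη, fun t ht => ?_⟩
    have h3 : 0 < slope φ 0 t := hsub ht
    rw [slope_def_field, hφ0, sub_zero, sub_zero] at h3
    exact (div_pos_iff_of_pos_right ht.1).1 h3
  obtain ⟨t₁, ht₁, hφt₁⟩ := exists_zero_of_sturm hc hφ hv hf hφ0
  have hηt₁ : η ≤ t₁ := by
    by_contra! h
    exact absurd (hηpos t₁ ⟨ht₁.1, h⟩) hφt₁.not_gt
  -- The first return time is the least element of a compact set of zeros kept away from `0`.
  set S : Set ℝ := Icc (η / 2) (Real.pi / c) ∩ φ ⁻¹' {0} with hS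
  have hSc : IsCompact S :=
    isCompact_Icc.of_isClosed_subset
      ((hφc.mono (Icc_subset_Icc_left (by linarith))).preimage_isClosed_of_isClosed isClosed_Icc
        isClosed_singleton) inter_subset_left
  have hSne : S.Nonempty := by
    have hsub : Icc (η / 2) t₁ ⊆ Icc 0 (Real.pi / c) :=
      Icc_subset_Icc (by linarith) ht₁.2
    obtain ⟨z, hz, hz0⟩ := intermediate_value_Icc' (by linarith) (hφc.mono hsub)
      ⟨hφt₁, (hηpos (η / 2) ⟨by linarith, by linarith⟩).le⟩
    exact ⟨z, ⟨hz.1, hz.2.trans ht₁.2⟩, hz0⟩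
  obtain ⟨τ, ⟨hτI, hτ0⟩, hτmin⟩ := hSc.exists_isLeast hSne
  have hτpos : 0 < τ := by linarith [hτI.1]
  have hpos : ∀ t ∈ Ioo 0 τ, 0 < φ t := by
    intro t ht
    rcases lt_or_ge t η with h | h
    · exact hηpos t ⟨ht.1, h⟩
    by_contra! hneg
    have hsub : Icc (η / 2) t ⊆ Icc 0 (Real.pi / c) :=
      Icc_subset_Icc (by linarith) (ht.2.le.trans hτI.2)
    obtain ⟨z, hz, hz0⟩ := intermediate_value_Icc' (by linarith) (hφc.mono hsub)
      ⟨hneg, (hηpos (η / 2) ⟨by linarith, by linarith⟩).le⟩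
    have := hτmin ⟨⟨hz.1, by linarith [hz.2, ht.2, hτI.2]⟩, hz0⟩
    linarith [hz.2, ht.2]
  refine ⟨τ, ⟨hτpos, hτI.2⟩, hτ0, hpos, ?_⟩
  have hsubτ : Icc 0 τ ⊆ Icc 0 (Real.pi / c) := Icc_subset_Icc_right hτI.2
  -- On `[0, τ]` the slope strictly decreases, and it vanishes somewhere inside by Rolle.
  have hanti : StrictAntiOn v (Icc 0 τ) := by
    refine strictAntiOn_of_hasDerivWithinAt_neg (convex_Icc _ _)
      (HasDerivAt.continuousOn fun t ht => hv t (hsubτ ht))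
      (fun t ht => (hv t (hsubτ (interior_subset ht))).hasDerivWithinAt) fun t ht => ?_
    rw [interior_Icc] at ht
    have h1 := hpos t ht
    have h2 := hf t (hsubτ (Ioo_subset_Icc_self ht)) h1
    nlinarith [mul_pos (pow_pos hc 2) h1]
  obtain ⟨ξ, hξ, hξ0⟩ := exists_hasDerivAt_eq_zero hτpos (hφc.mono hsubτ)
    (hφ0.trans hτ0.symm) fun t ht => hφ t (hsubτ (Ioo_subset_Icc_self ht))
  rw [← hξ0]
  exact hanti (Ioo_subset_Icc_self hξ) (right_mem_Icc.2 hτpos.le) hξ.2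

/-- The time of a transversal first return depends continuously on parameters. -/
theorem continuous_first_return {P : Type*} [TopologicalSpace P] {φ v : P → ℝ → ℝ} {τ : P → ℝ}
    (hφc : Continuous (Function.uncurry φ)) (hvc : Continuous (Function.uncurry v))
    (hφ : ∀ p t, HasDerivAt (φ p) (v p t) t) (hφ0 : ∀ p, φ p 0 = 0) (hv0 : ∀ p, 0 < v p 0)
    (hτ : ∀ p, 0 < τ p) (hφτ : ∀ p, φ p (τ p) = 0) (hpos : ∀ p, ∀ t ∈ Ioo 0 (τ p), 0 < φ p t)
    (hvτ : ∀ p, v p (τ p) < 0) : Continuous τ := by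
  refine continuous_iff_continuousAt.2 fun p => tendsto_order.2 ⟨fun a ha => ?_, fun a ha => ?_⟩
  · -- Near time `0` the slopes are uniformly positive; away from it, compactness applies.
    have h1 : ∀ᶠ z in 𝓝 (p, (0 : ℝ)), 0 < v z.1 z.2 :=
      hvc.continuousAt.eventually (lt_mem_nhds (hv0 p))
    rw [nhds_prod_eq] at h1
    obtain ⟨pa, hpa, pb, hpb, hab⟩ := eventually_prod_iff.1 h1
    obtain ⟨η, hη, hball⟩ := Metric.eventually_nhds_iff.1 hpb
    have h2 : ∀ᶠ q in 𝓝 p, ∀ t ∈ Icc (η / 2) a, 0 < φ q t := by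
      refine isCompact_Icc.eventually_forall_of_forall_eventually fun t ht => ?_
      exact hφc.continuousAt.eventually
        (lt_mem_nhds (hpos p t ⟨by linarith [ht.1], by linarith [ht.2]⟩))
    filter_upwards [hpa, h2] with q hq hq2
    by_contra! hle
    rcases lt_or_ge (τ q) η with h | h
    · have hmono : StrictMonoOn (φ q) (Icc 0 (τ q)) := by
        refine strictMonoOn_of_hasDerivWithinAt_pos (convex_Icc _ _)
          (HasDerivAt.continuousOn fun t _ => hφ q t)
          (fun t _ => (hφ q t).hasDerivWithinAt) fun t ht => ?_
        rw [interior_Icc] at ht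
        refine hab hq (hball ?_)
        rw [Real.dist_eq, sub_zero, abs_of_pos ht.1]
        exact ht.2.trans h
      have := hmono (left_mem_Icc.2 (hτ q).le) (right_mem_Icc.2 (hτ q).le) (hτ q)
      rw [hφ0, hφτ] at this
      exact lt_irrefl _ this
    · have := hq2 (τ q) ⟨by linarith, hle⟩
      rw [hφτ] at this
      exact lt_irrefl _ this
  · -- Just after `τ p` the function is negative, and it stays so at that time for nearby parameters.
    obtain ⟨s, hs, hsneg⟩ : ∃ s ∈ Ioo (τ p) a, φ p s < 0 := by
      have hd := (hφ p (τ p)).hasDerivWithinAt (s := Ioi (τ p))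
      have h := (hasDerivWithinAt_iff_tendsto_slope' (by simp)).1 hd
      obtain ⟨s, hs, hsI⟩ :=
        ((h.eventually (gt_mem_nhds (hvτ p))).and (Ioo_mem_nhdsGT ha)).exists
      refine ⟨s, hsI, ?_⟩
      rw [slope_def_field, hφτ, sub_zero] at hs
      by_contra! h0
      exact absurd (div_nonneg h0 (sub_nonneg.2 hsI.1.le)) (not_le.2 hs)
    have hcs : Continuous fun q => φ q s := hφc.comp (by fun_prop : Continuous fun q : P => (q, s))
    filter_upwards [hcs.continuousAt.eventually (gt_mem_nhds hsneg)] with q hq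
    by_contra! hle
    exact absurd (hpos q s ⟨(hτ p).trans hs.1, hs.2.trans_le hle⟩) hq.not_gt

end Return

/-! ### Reversible oscillators in three dimensions -/

section Oscillator

/-- The retraction of `ℝ³` onto the cube `[-δ, δ]³` (the closed ball of the sup norm) that truncates
each coordinate. -/
def cubeClamp (δ : ℝ) (x : ℝ × ℝ × ℝ) : ℝ × ℝ × ℝ :=
  (max (-δ) (min δ x.1), max (-δ) (min δ x.2.1), max (-δ) (min δ x.2.2))

theorem cubeClamp_of_norm_le {δ : ℝ} {x : ℝ × ℝ × ℝ} (hx : ‖x‖ ≤ δ) : cubeClamp δ x = x := by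
  obtain ⟨a, b, c⟩ := x
  simp only [Prod.norm_mk, Real.norm_eq_abs, sup_le_iff, abs_le] at hx
  simp only [cubeClamp, min_eq_right hx.1.2, min_eq_right hx.2.1.2, min_eq_right hx.2.2.2,
    max_eq_right hx.1.1, max_eq_right hx.2.1.1, max_eq_right hx.2.2.1]

theorem norm_cubeClamp_le {δ : ℝ} (hδ : 0 ≤ δ) (x : ℝ × ℝ × ℝ) : ‖cubeClamp δ x‖ ≤ δ := by
  have h : ∀ y : ℝ, |max (-δ) (min δ y)| ≤ δ := fun y =>
    abs_le.2 ⟨le_max_left _ _, max_le (by linarith) (min_le_left _ _)⟩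
  simp only [cubeClamp, Prod.norm_mk, Real.norm_eq_abs, sup_le_iff]
  exact ⟨h _, h _, h _⟩

theorem lipschitzWith_cubeClamp (δ : ℝ) : LipschitzWith 1 (cubeClamp δ) := by
  have h : LipschitzWith 1 fun y : ℝ => max (-δ) (min δ y) :=
    (LipschitzWith.id.const_min δ).const_max (-δ)
  have h1 := h.comp (LipschitzWith.prod_fst (α := ℝ) (β := ℝ × ℝ))
  have h2 := h.comp ((LipschitzWith.prod_fst (α := ℝ) (β := ℝ)).comp
    (LipschitzWith.prod_snd (α := ℝ) (β := ℝ × ℝ)))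
  have h3 := h.comp ((LipschitzWith.prod_snd (α := ℝ) (β := ℝ)).comp
    (LipschitzWith.prod_snd (α := ℝ) (β := ℝ × ℝ)))
  simpa using! h1.prodMk (h2.prodMk h3)

/-- The reflection `(φ, v, w) ↦ (-φ, v, w)`; its fixed set is the plane `φ = 0`. -/
def reflectFst : ℝ × ℝ × ℝ →L[ℝ] ℝ × ℝ × ℝ :=
  (-ContinuousLinearMap.fst ℝ ℝ (ℝ × ℝ)).prod (ContinuousLinearMap.snd ℝ ℝ (ℝ × ℝ))

@[simp]
theorem reflectFst_apply (x : ℝ × ℝ × ℝ) : reflectFst x = (-x.1, x.2) := rfl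

theorem cubeClamp_reflectFst {δ : ℝ} (hδ : 0 ≤ δ) (x : ℝ × ℝ × ℝ) :
    cubeClamp δ (reflectFst x) = reflectFst (cubeClamp δ x) := by
  simp only [cubeClamp, reflectFst_apply, Prod.mk.injEq, and_true]
  rcases le_total δ x.1 with h | h <;> rcases le_total (-δ) x.1 with h' | h' <;> grind

/-- A field on `ℝ³` that is Lipschitz near the origin, is reversed by `(φ, v, w) ↦ (-φ, v, w)`,
has `φ' = v` and a restoring force `v' ≤ -c² φ` for small `φ > 0`, has a two-parameter family of
periodic solutions. Since the fixed plane `φ = 0` of the reversing symmetry is two-dimensional,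
the starting points `(0, a, b)` with small `a > 0` and small `b` are the parameters. -/
theorem hasTwoParameterFamilyOfPeriodicSolutions_of_reversible {X : ℝ × ℝ × ℝ → ℝ × ℝ × ℝ}
    {K : ℝ≥0} {s : Set (ℝ × ℝ × ℝ)} (hs : s ∈ 𝓝 0) (hlip : LipschitzOnWith K X s)
    (hfst : ∀ x, (X x).1 = x.2.1) (hrev : ∀ x, X (reflectFst x) = -reflectFst (X x))
    {c : ℝ} (hc : 0 < c) (hneg : ∀ᶠ x in 𝓝 0, 0 < x.1 → (X x).2.1 ≤ -c ^ 2 * x.1) :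
    HasTwoParameterFamilyOfPeriodicSolutions X := by
  obtain ⟨δ, hδ, hball⟩ : ∃ δ > 0, ∀ x : ℝ × ℝ × ℝ, ‖x‖ ≤ δ →
      x ∈ s ∧ (0 < x.1 → (X x).2.1 ≤ -c ^ 2 * x.1) := by
    obtain ⟨δ, hδ, hsub⟩ := Metric.nhds_basis_closedBall.eventually_iff.1 (hneg.and hs)
    refine ⟨δ, hδ, fun x hx => (hsub ?_).symm⟩
    simpa using hx
  have hX0 : X 0 = 0 := by
    have h := hrev 0
    have h1 := hfst 0
    rw [map_zero] at h
    refine Prod.ext (by simpa using h1) ?_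
    have h2 : (X 0).2 = -(X 0).2 := congrArg Prod.snd h
    exact self_eq_neg.1 h2
  -- Truncation outside the cube gives a bounded, globally Lipschitz, still reversible field.
  set Y : ℝ × ℝ × ℝ → ℝ × ℝ × ℝ := fun x => X (cubeClamp δ x) with hYdef
  have hYX : ∀ x, ‖x‖ ≤ δ → Y x = X x := fun x hx => by
    simp only [hYdef, cubeClamp_of_norm_le hx]
  have hYlip : LipschitzWith K Y := by
    have h := hlip.comp (f := cubeClamp δ) (s := univ)
      (lipschitzWith_cubeClamp δ).lipschitzOnWith
      fun x _ => (hball _ (norm_cubeClamp_le hδ.le x)).1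
    rw [mul_one] at h
    exact lipschitzOnWith_univ.1 h
  have hY0 : Y 0 = 0 := by rw [hYX 0 (by simpa using hδ.le), hX0]
  have hYbdd : ∀ x, ‖Y x‖ ≤ (K * ⟨δ, hδ.le⟩ : ℝ≥0) := fun x => by
    have h := hlip.dist_le_mul _ (hball _ (norm_cubeClamp_le hδ.le x)).1 0
      (hball 0 (by simpa using hδ.le)).1
    rw [hX0, dist_zero_right, dist_zero_right] at h
    exact h.trans (mul_le_mul_of_nonneg_left (norm_cubeClamp_le hδ.le x) K.2)
  have hYrev : ∀ x, Y (reflectFst x) = -reflectFst (Y x) := fun x => by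
    simp only [hYdef, cubeClamp_reflectFst hδ.le, hrev]
  obtain ⟨Φ, hΦ⟩ := hYlip.exists_global_flow hYbdd
  have hΦ0 : ∀ x, Φ x 0 = x := fun x => (hΦ x).1
  have hΦd : ∀ x t, HasDerivAt (Φ x) (Y (Φ x t)) t := fun x => (hΦ x).2
  have hΦc : Continuous (Function.uncurry Φ) := hYlip.continuous_flow hΦ0 hΦd
  set M : ℝ := Real.pi / c with hM
  -- Starting points within `ρ` of the equilibrium `0` stay in the cube up to time `M`.
  set ρ : ℝ := δ * Real.exp (-(K * M)) with hρ
  have hρpos : 0 < ρ := mul_pos hδ (Real.exp_pos _)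
  have hsmall : ∀ x, ‖x‖ ≤ ρ → ∀ t, |t| ≤ M → ‖Φ x t‖ ≤ δ := by
    intro x hx t ht
    have h := hYlip.dist_solution_le (hΦd x) (g := fun _ => 0)
      (fun t => by simpa [hY0] using hasDerivAt_const t (0 : ℝ × ℝ × ℝ)) t
    rw [dist_zero_right, dist_zero_right, hΦ0] at h
    calc ‖Φ x t‖ ≤ ‖x‖ * Real.exp (K * |t|) := h
      _ ≤ ρ * Real.exp (K * M) := by gcongr
      _ = δ := by rw [hρ, mul_assoc, ← Real.exp_add, neg_add_cancel, Real.exp_zero, mul_one]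
  set U : Set (ℝ × ℝ) := Ioo 0 ρ ×ˢ Ioo (-ρ) ρ with hU
  set γ : ℝ × ℝ → ℝ → ℝ × ℝ × ℝ := fun p => Φ (0, p) with hγ
  have hγ0 : ∀ p, γ p 0 = (0, p) := fun p => hΦ0 _
  have hγd : ∀ p t, HasDerivAt (γ p) (Y (γ p t)) t := fun p t => hΦd _ t
  have hγsmall : ∀ p ∈ U, ∀ t, |t| ≤ M → ‖γ p t‖ ≤ δ := by
    rintro ⟨a, b⟩ ⟨ha, hb⟩
    refine hsmall _ ?_
    simp only [Prod.norm_mk, norm_zero, Real.norm_eq_abs, sup_le_iff, abs_of_pos ha.1]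
    exact ⟨hρpos.le, ha.2.le, (abs_lt.2 hb).le⟩
  have hφd : ∀ p t, ‖γ p t‖ ≤ δ → HasDerivAt (fun t => (γ p t).1) (γ p t).2.1 t := by
    intro p t ht
    have h := (ContinuousLinearMap.fst ℝ ℝ (ℝ × ℝ)).hasFDerivAt.comp_hasDerivAt t (hγd p t)
    refine h.congr_deriv ?_
    rw [hYX _ ht]
    exact hfst _
  have hvd : ∀ p t, HasDerivAt (fun t => (γ p t).2.1) (Y (γ p t)).2.1 t := fun p t =>
    ((ContinuousLinearMap.fst ℝ ℝ ℝ).comp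
      (ContinuousLinearMap.snd ℝ ℝ (ℝ × ℝ))).hasFDerivAt.comp_hasDerivAt t (hγd p t)
  have hret : ∀ p : ℝ × ℝ, ∃ τ : ℝ, p ∈ U → τ ∈ Ioc 0 M ∧ (γ p τ).1 = 0 ∧
      (∀ t ∈ Ioo 0 τ, 0 < (γ p t).1) ∧ (γ p τ).2.1 < 0 := by
    intro p
    by_cases hp : p ∈ U
    · have hin : ∀ t ∈ Icc 0 M, ‖γ p t‖ ≤ δ := fun t ht =>
        hγsmall p hp t (by rw [abs_of_nonneg ht.1]; exact ht.2)
      obtain ⟨τ, h⟩ := exists_first_return hc (fun t ht => hφd p t (hin t ht))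
        (fun t _ => hvd p t)
        (fun t ht hpos => by
          rw [hYX _ (hin t ht)]
          exact (hball _ (hin t ht)).2 hpos)
        (by simp [hγ0]) (by simpa [hγ0] using hp.1.1)
      exact ⟨τ, fun _ => h⟩
    · exact ⟨0, fun h => absurd h hp⟩
  choose τ hτ using hret
  have hfix : ∀ p t, (γ p t).1 = 0 → reflectFst (γ p t) = γ p t := fun p t h =>
    Prod.ext (by simp [h]) rfl
  have hper : ∀ p ∈ U, Function.Periodic (γ p) (2 * τ p) := fun p hp =>
    hYlip.solution_periodic_of_reflect hYrev (hγd p) (hfix p 0 (by simp [hγ0]))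
      (hfix p _ (hτ p hp).2.1)
  have hodd : ∀ p t, reflectFst (γ p (-t)) = γ p t := fun p t => by
    simpa using hYlip.solution_reflect hYrev (hγd p) (hfix p 0 (by simp [hγ0])) t
  -- Every value of a solution is attained during the period centred at time `0`.
  have hperiod : ∀ p ∈ U, ∀ t, ∃ t' ∈ Ioc (-τ p) (τ p), γ p t = γ p t' := by
    intro p hp t
    obtain ⟨t', ht', h⟩ := (hper p hp).exists_mem_Ioc (by linarith [(hτ p hp).1.1]) t (-τ p)
    exact ⟨t', ⟨ht'.1, by linarith [ht'.2]⟩, h⟩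
  have hin : ∀ p ∈ U, ∀ t, ‖γ p t‖ ≤ δ := by
    intro p hp t
    obtain ⟨t', ht', h⟩ := hperiod p hp t
    rw [h]
    exact hγsmall p hp t' ((abs_le.2 ⟨ht'.1.le, ht'.2⟩).trans (hτ p hp).1.2)
  have hγc : Continuous (Function.uncurry γ) :=
    hΦc.comp (by fun_prop : Continuous fun q : (ℝ × ℝ) × ℝ => (((0 : ℝ), q.1), q.2))
  have hτc : ContinuousOn τ U := by
    rw [continuousOn_iff_continuous_domRestrict]
    have hγU : Continuous fun q : U × ℝ => γ q.1 q.2 :=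
      hγc.comp (by fun_prop : Continuous fun q : U × ℝ => ((q.1 : ℝ × ℝ), q.2))
    exact continuous_first_return (P := U) (φ := fun p t => (γ p t).1)
      (v := fun p t => (γ p t).2.1) hγU.fst hγU.snd.fst
      (fun p t => hφd p t (hin p p.2 t)) (fun p => by simp [hγ0])
      (fun p => by simpa [hγ0] using p.2.1.1) (fun p => (hτ p p.2).1.1)
      (fun p => (hτ p p.2).2.1) (fun p => (hτ p p.2).2.2.1) (fun p => (hτ p p.2).2.2.2)
  have hγ0' : (fun q => γ q 0) = ContinuousLinearMap.inr ℝ ℝ (ℝ × ℝ) := funext fun q => hγ0 q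
  refine ⟨U, γ, fun p => 2 * τ p, isOpen_Ioo.prod isOpen_Ioo,
    ⟨(ρ / 2, 0), ⟨by linarith, by linarith⟩, ⟨by linarith, by linarith⟩⟩,
    fun p hp t => (hYX _ (hin p hp t)) ▸ hγd p t,
    fun p hp => ⟨by linarith [(hτ p hp).1.1], hper p hp⟩, hγc.continuousOn,
    continuousOn_const.mul hτc, ?_, ?_, ?_⟩
  · rw [hγ0']
    exact (ContinuousLinearMap.inr ℝ ℝ (ℝ × ℝ)).contDiff.contDiffOn
  · intro p hp a b h
    rw [hγ0', ContinuousLinearMap.fderiv, hγ0] at h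
    have h1 := congrArg Prod.fst h
    have h2 := congrArg Prod.snd h
    simp only [ContinuousLinearMap.inr_apply, Prod.fst_add, Prod.smul_fst, hfst, zero_add,
      smul_eq_mul, Prod.fst_zero, mul_eq_zero, hp.1.1.ne', or_false] at h1
    subst h1
    exact ⟨by simpa using h2, rfl⟩
  · intro p hp q hq t₁ t₂ h
    -- The orbit of `p` passes through the start of `q`, where `φ = 0` and `v > 0`; within one
    -- period the orbit of `p` does so only at time `0`.
    have hshift : ∀ t, HasDerivAt (fun t => γ p (t + (t₁ - t₂))) (Y (γ p (t + (t₁ - t₂)))) t :=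
      fun t => (hγd p _).comp_add_const t _
    have heq := hYlip.eq_of_hasDerivAt hshift (hγd q) (t₀ := t₂)
      (by simpa only [add_sub_cancel] using h)
    have hq0 : γ p (0 + (t₁ - t₂)) = (0, q) := (congrFun heq 0).trans (hγ0 q)
    obtain ⟨t, ht, hpt⟩ := hperiod p hp (0 + (t₁ - t₂))
    rw [hpt] at hq0
    obtain ⟨-, hτ0, hτpos, hτneg⟩ := hτ p hp
    rcases lt_trichotomy t 0 with h0 | h0 | h0
    · have h1 := hτpos (-t) ⟨by linarith, by linarith [ht.1]⟩
      have h2 := congrArg Prod.fst (hodd p (-t))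
      rw [neg_neg, reflectFst_apply, hq0] at h2
      simp only [neg_zero] at h2
      linarith
    · rw [h0, hγ0] at hq0
      exact congrArg Prod.snd hq0
    · rcases ht.2.lt_or_eq with h1 | h1
      · have h2 := hτpos t ⟨h0, h1⟩
        rw [hq0] at h2
        exact absurd h2 (lt_irrefl _)
      · rw [← h1, hq0] at hτneg
        exact absurd hq.1.1 hτneg.not_gt

end Oscillator

/-! ### The pendulum -/

namespace ZieglerPendulum

variable (P : ZieglerPendulum)

theorem A₁₁_pos : 0 < P.A₁₁ := by
  have := P.m₁_pos; have := P.m₃_pos; have := P.l₁_pos; have := P.l₃_pos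
  unfold A₁₁
  positivity

/-- The mass matrix has positive determinant at `φ₁ = 0`. -/
theorem A₁₂_mul_self_lt : P.A₁₂ 0 * P.A₁₂ 0 < P.A₁₁ * P.A₂₂ 0 := by
  have h1 := P.m₁_pos; have h2 := P.m₂_pos; have h3 := P.m₃_pos
  have h4 := P.l₁_pos; have h5 := P.l₂_pos; have h6 := P.l₃_pos
  have key : P.A₁₁ * P.A₂₂ 0 - P.A₁₂ 0 * P.A₁₂ 0 =
      P.l₂ ^ 2 * (P.m₂ * P.A₁₁ + P.m₁ * P.m₃ * (P.l₁ + P.l₃) ^ 2) := by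
    simp only [A₁₁, A₁₂, A₂₂, Real.cos_zero]
    ring
  have hA := P.A₁₁_pos
  have : 0 < P.l₂ ^ 2 * (P.m₂ * P.A₁₁ + P.m₁ * P.m₃ * (P.l₁ + P.l₃) ^ 2) := by positivity
  linarith

theorem A₂₂_zero_pos : 0 < P.A₂₂ 0 := by
  have h := (mul_self_nonneg (P.A₁₂ 0)).trans_lt P.A₁₂_mul_self_lt
  exact (mul_pos_iff_of_pos_left P.A₁₁_pos).1 h

theorem schurComplement₁_pos : 0 < P.A₁₁ - P.A₁₂ 0 * P.A₁₂ 0 / P.A₂₂ 0 := by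
  rw [sub_pos, div_lt_iff₀ P.A₂₂_zero_pos]
  exact P.A₁₂_mul_self_lt

theorem schurComplement₂_pos : 0 < P.A₂₂ 0 - P.A₁₂ 0 * P.A₁₂ 0 / P.A₁₁ := by
  rw [sub_pos, div_lt_iff₀ P.A₁₁_pos, mul_comm (P.A₂₂ 0)]
  exact P.A₁₂_mul_self_lt

theorem contDiff_A₁₂ : ContDiff ℝ 1 P.A₁₂ := by
  unfold A₁₂
  fun_prop

theorem contDiff_A₂₂ : ContDiff ℝ 1 P.A₂₂ := by
  unfold A₂₂
  fun_prop

theorem contDiffAt_reducedField (k₁ F : ℝ) : ContDiffAt ℝ 1 (P.reducedField k₁ F) 0 := by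
  have h12 : ContDiffAt ℝ 1 (fun x : ℝ × ℝ × ℝ => P.A₁₂ x.1) 0 :=
    (P.contDiff_A₁₂.comp contDiff_fst).contDiffAt
  have h22 : ContDiffAt ℝ 1 (fun x : ℝ × ℝ × ℝ => P.A₂₂ x.1) 0 :=
    (P.contDiff_A₂₂.comp contDiff_fst).contDiffAt
  have hr1 : ContDiffAt ℝ 1 (fun x : ℝ × ℝ × ℝ => P.r₁ k₁ x.1 x.2.2) 0 := by
    unfold r₁
    fun_prop
  have hr2 : ContDiffAt ℝ 1 (fun x : ℝ × ℝ × ℝ => P.r₂ F x.1 x.2.1 x.2.2) 0 := by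
    unfold r₂
    fun_prop
  have h11 : ContDiffAt ℝ 1 (fun _ : ℝ × ℝ × ℝ => P.A₁₁) 0 := contDiffAt_const
  have hv : ContDiffAt ℝ 1 (fun x : ℝ × ℝ × ℝ => x.2.1) 0 := by fun_prop
  exact hv.prodMk
    (((hr1.sub ((h12.div h22 P.A₂₂_zero_pos.ne').mul hr2)).mul
      ((h11.sub ((h12.mul h12).div h22 P.A₂₂_zero_pos.ne')).inv P.schurComplement₁_pos.ne')).prodMk
    ((hr2.sub ((h12.div h11 P.A₁₁_pos.ne').mul hr1)).mul
      ((h22.sub ((h12.mul h12).div h11 P.A₁₁_pos.ne')).inv P.schurComplement₂_pos.ne')))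

theorem reducedField_reflectFst (k₁ F : ℝ) (x : ℝ × ℝ × ℝ) :
    P.reducedField k₁ F (reflectFst x) = -reflectFst (P.reducedField k₁ F x) := by
  obtain ⟨φ, v, w⟩ := x
  have h12 : P.A₁₂ (-φ) = P.A₁₂ φ := by simp [A₁₂]
  have h22 : P.A₂₂ (-φ) = P.A₂₂ φ := by simp [A₂₂]
  have hr1 : P.r₁ k₁ (-φ) w = -P.r₁ k₁ φ w := by
    simp only [r₁, Real.sin_neg]
    ring
  have hr2 : P.r₂ F (-φ) v w = -P.r₂ F φ v w := by
    simp only [r₂, Real.sin_neg]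
    ring
  simp only [reducedField, reflectFst_apply, h12, h22, hr1, hr2, Prod.neg_mk, neg_neg,
    Prod.mk.injEq, true_and]
  constructor <;> ring

/-- The restoring coefficient `-v₁' / φ₁`, extended continuously to `φ₁ = 0` by means of
`sinc`. -/
noncomputable def stiffness (k₁ F : ℝ) (x : ℝ × ℝ × ℝ) : ℝ :=
  (k₁ + (P.m₁ * P.l₁ * P.l₂ - P.m₃ * P.l₂ * P.l₃) * x.2.2 ^ 2 * Real.sinc x.1
    - P.A₁₂ x.1 / P.A₂₂ x.1 * ((F * P.l₁ - (P.m₁ * P.l₁ * P.l₂ - P.m₃ * P.l₂ * P.l₃) *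
      (x.2.1 * (x.2.1 + 2 * x.2.2))) * Real.sinc x.1))
  * (P.A₁₁ - P.A₁₂ x.1 * P.A₁₂ x.1 / P.A₂₂ x.1)⁻¹

theorem reducedField_snd_fst (k₁ F : ℝ) (x : ℝ × ℝ × ℝ) :
    (P.reducedField k₁ F x).2.1 = -P.stiffness k₁ F x * x.1 := by
  obtain ⟨φ, v, w⟩ := x
  have hsin : Real.sin φ = Real.sinc φ * φ := by
    rcases eq_or_ne φ 0 with rfl | h
    · simp
    · rw [Real.sinc_of_ne_zero h, div_mul_cancel₀ _ h]
  simp only [reducedField, stiffness, r₁, r₂, hsin]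
  ring

theorem continuousAt_stiffness (k₁ F : ℝ) : ContinuousAt (P.stiffness k₁ F) 0 := by
  have h12 : ContinuousAt (fun x : ℝ × ℝ × ℝ => P.A₁₂ x.1) 0 :=
    (P.contDiff_A₁₂.continuous.comp continuous_fst).continuousAt
  have h22 : ContinuousAt (fun x : ℝ × ℝ × ℝ => P.A₂₂ x.1) 0 :=
    (P.contDiff_A₂₂.continuous.comp continuous_fst).continuousAt
  have hsinc : ContinuousAt (fun x : ℝ × ℝ × ℝ => Real.sinc x.1) 0 :=
    (Real.continuous_sinc.comp continuous_fst).continuousAt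
  have hq := h12.div h22 P.A₂₂_zero_pos.ne'
  have hinv : ContinuousAt
      (fun x : ℝ × ℝ × ℝ => (P.A₁₁ - P.A₁₂ x.1 * P.A₁₂ x.1 / P.A₂₂ x.1)⁻¹) 0 :=
    (continuousAt_const.sub ((h12.mul h12).div h22 P.A₂₂_zero_pos.ne')).inv₀ P.schurComplement₁_pos.ne'
  unfold stiffness
  exact ContinuousAt.mul (.sub (by fun_prop) (hq.mul (by fun_prop))) hinv

theorem stiffness_zero_pos {k₁ F : ℝ} (hF : P.A₁₂ 0 / P.A₂₂ 0 * (F * P.l₁) < k₁) :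
    0 < P.stiffness k₁ F 0 := by
  simp only [stiffness, Prod.fst_zero, Prod.snd_zero, Real.sinc_zero]
  refine mul_pos ?_ (inv_pos.2 P.schurComplement₁_pos)
  linarith

end ZieglerPendulum

theorem proposition5 (P : ZieglerPendulum) :
    ∃ K₁ : ℝ, ∀ k₁ : ℝ, K₁ < k₁ →
      ∃ ε : ℝ, 0 < ε ∧ ∀ F : ℝ, |F| < ε →
        HasTwoParameterFamilyOfPeriodicSolutions (P.reducedField k₁ F) := by
  refine ⟨0, fun k₁ hk => ?_⟩
  set B : ℝ := |P.A₁₂ 0 / P.A₂₂ 0 * P.l₁| with hB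
  have hB1 : 0 < B + 1 := by positivity
  -- This bound on `F` keeps the frequency of the linearization at the origin real.
  refine ⟨k₁ / (B + 1), by positivity, fun F hF => ?_⟩
  have hstiff : 0 < P.stiffness k₁ F 0 := by
    refine P.stiffness_zero_pos ?_
    calc P.A₁₂ 0 / P.A₂₂ 0 * (F * P.l₁) ≤ |P.A₁₂ 0 / P.A₂₂ 0 * (F * P.l₁)| := le_abs_self _
      _ = |F| * B := by rw [hB, ← abs_mul]; ring_nf
      _ ≤ |F| * (B + 1) := by gcongr; linarith
      _ < k₁ := (lt_div_iff₀ hB1).1 hF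
  obtain ⟨K, s, hs, hlip⟩ := (P.contDiffAt_reducedField k₁ F).exists_lipschitzOnWith
  refine hasTwoParameterFamilyOfPeriodicSolutions_of_reversible hs hlip (fun x => rfl)
    (P.reducedField_reflectFst k₁ F) (c := √(P.stiffness k₁ F 0 / 2))
    (Real.sqrt_pos.2 (by linarith)) ?_
  filter_upwards [(P.continuousAt_stiffness k₁ F).eventually (lt_mem_nhds (half_lt_self hstiff))]
    with x hx hpos
  rw [P.reducedField_snd_fst, Real.sq_sqrt (by linarith)]
  exact mul_le_mul_of_nonneg_right (neg_le_neg hx.le) hpos.le
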